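/- For $\lambda\in\mathbb{C}$ with $\operatorname{Re}\lambda>-1$ let $x_+^\lambda=\mathbf 1_{\{x>0\}}x^\lambda$ and $x_-^\lambda=\mathbf 1_{\{x<0\}}|x|^\lambda$, and let $[x_\pm^\lambda]\in\mathcal S'(\mathbb R)$ be the tempered distributions $\varphi\mapsto\int_{\mathbb R}x_\pm^\lambda\,\varphi(x)\,dx$. Call a family $T_\lambda\in\mathcal S'(\mathbb R)$ holomorphic on an open set $U\subset\mathbb C$ if $\lambda\mapsto\langle T_\lambda,\varphi\rangle$ is holomorphic on $U$ for every $\varphi\in\mathcal S(\mathbb R)$. The families $[x_+^\lambda]$ and $[x_-^\lambda]$ have a (unique) holomorphic continuation to $\mathbb C\setminus\{-1,-2,-3,\dots\}$, again denoted by $[x_\pm^\lambda]$. For $h>0$ let $\mathcal F_h$ be the semiclassical Fourier transform $$\mathcal F_h(f)(\xi)=\frac1{\sqrt{2\pi h}}\int_{-\infty}^{+\infty}f(t)\,e^{-i\xi t/h}\,dt ,$$ extended to $\mathcal S'(\mathbb R)$ by $\langle\mathcal F_hT,\varphi\rangle=\langle T,\mathcal F_h\varphi\rangle$. Then for every $h>0$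 and every $\lambda\in\mathbb C\setminus\mathbb Z$, in $\mathcal S'(\mathbb R)$, $$\mathcal F_h\big([x_+^\lambda]\big)=\frac{i\,\Gamma(\lambda+1)}{\sqrt{2\pi}}\,h^{\lambda+\frac12}\Big(e^{i\frac\pi2\lambda}[\xi_-^{-\lambda-1}]-e^{-i\frac\pi2\lambda}[\xi_+^{-\lambda-1}]\Big),$$ $$\mathcal F_h\big([x_-^\lambda]\big)=\frac{i\,\Gamma(\lambda+1)}{\sqrt{2\pi}}\,h^{\lambda+\frac12}\Big(e^{i\frac\pi2\lambda}[\xi_+^{-\lambda-1}]-e^{-i\frac\pi2\lambda}[\xi_-^{-\lambda-1}]\Big).$$ For $\lambda=0$, where $[\xi_\pm^{-\lambda-1}]$ have poles, the formulas hold in the sense of limits: as $\mu\to0$, $\mu\neq0$, the right-hand sides with $\lambda$ replaced by $\mu$ converge in $\mathcal S'(\mathbb R)$ (tested against each Schwartz function) to $\mathcal F_h([x_+^0])$ and $\mathcal F_h([x_-^0])$ respectively. -/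

import Mathlib

open MeasureTheory Set Filter Topology
open scoped SchwartzMap FourierTransform

noncomputable section

/-! ### Functions as tempered distributions -/

/-- `f` is integrable against some negative power of `1 + |x|`, so that
`φ ↦ ∫ f φ` is a tempered distribution. -/
def IsTemperedFun (f : ℝ → ℂ) : Prop :=
  ∃ k : ℕ, Integrable (fun x : ℝ => (((1 + ‖x‖) ^ k : ℝ) : ℂ)⁻¹ * f x)

/-- Pointwise bound of a Schwartz function by its seminorms. -/
theorem schwartz_pointwise_bound (k : ℕ) (φ : 𝓢(ℝ, ℂ)) (x : ℝ) :
    (1 + ‖x‖) ^ k * ‖φ x‖ ≤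
      2 ^ k * ((Finset.Iic (k, 0)).sup (schwartzSeminormFamily ℂ ℝ ℂ)) φ := by
  have h := SchwartzMap.one_add_le_sup_seminorm_apply (𝕜 := ℂ) (m := (k, 0)) (k := k) (n := 0)
    le_rfl le_rfl φ x
  simpa using! h

/-- Pointwise bound of the integrand `f φ`. -/
theorem tempered_integrand_bound (f : ℝ → ℂ) (k : ℕ) (φ : 𝓢(ℝ, ℂ)) (x : ℝ) :
    ‖f x * φ x‖ ≤ ‖(((1 + ‖x‖) ^ k : ℝ) : ℂ)⁻¹ * f x‖ *
      (2 ^ k * ((Finset.Iic (k, 0)).sup (schwartzSeminormFamily ℂ ℝ ℂ)) φ) := by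
  have h := schwartz_pointwise_bound k φ x
  have hp : 0 < (1 + ‖x‖) ^ k := by positivity
  calc ‖f x * φ x‖ = ‖(((1 + ‖x‖) ^ k : ℝ) : ℂ)⁻¹ * f x‖ * ((1 + ‖x‖) ^ k * ‖φ x‖) := by
        rw [norm_mul, norm_mul, norm_inv, Complex.norm_real, Real.norm_of_nonneg hp.le]
        field_simp
    _ ≤ _ := by gcongr

/-- The integrand `f φ` is integrable. -/
theorem IsTemperedFun.integrable {f : ℝ → ℂ} (hf : IsTemperedFun f) (φ : 𝓢(ℝ, ℂ)) :
    Integrable (fun x => f x * φ x) := by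
  obtain ⟨k, hk⟩ := hf
  refine Integrable.mono' (hk.norm.mul_const _) ?_
    (Eventually.of_forall (tempered_integrand_bound f k φ))
  have hw : Continuous fun x : ℝ => (((1 + ‖x‖) ^ k : ℝ) : ℂ) := by fun_prop
  have := ((hw.aestronglyMeasurable.mul hk.aestronglyMeasurable).mul
    φ.continuous.aestronglyMeasurable)
  refine this.congr (Eventually.of_forall fun x => ?_)
  have hp : (((1 + ‖x‖) ^ k : ℝ) : ℂ) ≠ 0 := by
    have : 0 < (1 + ‖x‖) ^ k := by positivity
    exact_mod_cast this.ne'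
  simp only [Pi.mul_apply]
  rw [mul_inv_cancel_left₀ hp]

/-- The tempered distribution `φ ↦ ∫ f(x) φ(x) dx` of a function `f`. -/
def IsTemperedFun.toDistribution {f : ℝ → ℂ} (hf : IsTemperedFun f) : 𝓢'(ℝ, ℂ) :=
  ContinuousLinearMap.toPointwiseConvergenceCLM _ _ _ _
    (SchwartzMap.mkCLMtoNormedSpace (σ := RingHom.id ℂ) (fun φ : 𝓢(ℝ, ℂ) => ∫ x, f x * φ x)
      (fun φ ψ => by
        rw [← integral_add (hf.integrable φ) (hf.integrable ψ)]
        simp [mul_add])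
      (fun a φ => by
        simp only [smul_apply, smul_eq_mul, RingHom.id_apply]
        rw [← integral_const_mul]
        congr 1; ext x; ring)
      (by
        obtain ⟨k, hk⟩ := hf
        refine ⟨Finset.Iic (k, 0),
          (∫ x, ‖(((1 + ‖x‖) ^ k : ℝ) : ℂ)⁻¹ * f x‖) * 2 ^ k, by positivity, fun φ => ?_⟩
        refine (norm_integral_le_of_norm_le (hk.norm.mul_const _)
          (Eventually.of_forall (tempered_integrand_bound f k φ))).trans_eq ?_
        rw [integral_mul_const, mul_assoc]))

theorem IsTemperedFun.toDistribution_apply {f : ℝ → ℂ} (hf : IsTemperedFun f) (φ : 𝓢(ℝ, ℂ)) :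
    hf.toDistribution φ = ∫ x, f x * φ x := rfl

/-! ### The functions `x_+^l` and `x_-^l` -/

/-- The function `x_+^l`, equal to `x^l` for `x > 0` and to `0` for `x ≤ 0`. -/
def xPlusFun (l : ℂ) : ℝ → ℂ := (Ioi (0 : ℝ)).indicator fun x => (x : ℂ) ^ l

/-- The function `x_-^l`, equal to `|x|^l` for `x < 0` and to `0` for `x ≥ 0`. -/
def xMinusFun (l : ℂ) : ℝ → ℂ := (Iio (0 : ℝ)).indicator fun x => ((|x| : ℝ) : ℂ) ^ l

theorem xMinusFun_eq (l : ℂ) (x : ℝ) : xMinusFun l x = xPlusFun l (-x) := by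
  unfold xMinusFun xPlusFun
  by_cases hx : x < 0
  · simp [indicator, hx, abs_of_neg hx]
  · simp [indicator, hx]

theorem isTemperedFun_xPlusFun {l : ℂ} (hl : -1 < l.re) : IsTemperedFun (xPlusFun l) := by
  obtain ⟨k, hk⟩ := exists_nat_gt (l.re + 1)
  refine ⟨k, ?_⟩
  have hrw : (fun x : ℝ => (((1 + ‖x‖) ^ k : ℝ) : ℂ)⁻¹ * xPlusFun l x) =
      (Ioi (0 : ℝ)).indicator
        fun x : ℝ => (((1 + ‖x‖) ^ k : ℝ) : ℂ)⁻¹ * (x : ℂ) ^ l := by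
    ext x
    by_cases hx : 0 < x <;> simp [xPlusFun, indicator, hx]
  rw [hrw, integrable_indicator_iff measurableSet_Ioi,
    ← Ioc_union_Ioi_eq_Ioi (zero_le_one (α := ℝ)), integrableOn_union]
  have hmeas : AEStronglyMeasurable
      (fun x : ℝ => (((1 + ‖x‖) ^ k : ℝ) : ℂ)⁻¹ * (x : ℂ) ^ l) volume :=
    (by fun_prop : Measurable fun x : ℝ =>
      (((1 + ‖x‖) ^ k : ℝ) : ℂ)⁻¹ * (x : ℂ) ^ l).aestronglyMeasurable
  have hnorm : ∀ x : ℝ, 0 < x → ‖(((1 + ‖x‖) ^ k : ℝ) : ℂ)⁻¹ * (x : ℂ) ^ l‖ =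
      ((1 + x) ^ k)⁻¹ * x ^ l.re := by
    intro x hx
    have hp : 0 < (1 + x) ^ k := by positivity
    rw [norm_mul, norm_inv, Complex.norm_real, Complex.norm_cpow_eq_rpow_re_of_pos hx,
      Real.norm_of_nonneg hx.le, Real.norm_of_nonneg hp.le]
  constructor
  · have h1 := (intervalIntegrable_iff_integrableOn_Ioc_of_le zero_le_one).1
      (intervalIntegral.intervalIntegrable_rpow' (a := 0) (b := 1) hl)
    refine Integrable.mono' h1 hmeas.restrict ?_
    refine (ae_restrict_iff' measurableSet_Ioc).2 (Eventually.of_forall fun x hx => ?_)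
    rw [hnorm x hx.1]
    have : ((1 + x) ^ k)⁻¹ ≤ 1 :=
      inv_le_one_of_one_le₀ (one_le_pow₀ (by linarith [hx.1]))
    have h2 : 0 ≤ x ^ l.re := Real.rpow_nonneg hx.1.le _
    nlinarith
  · have h1 := integrableOn_Ioi_rpow_of_lt (a := l.re - k) (c := 1) (by linarith) one_pos
    refine Integrable.mono' h1 hmeas.restrict ?_
    refine (ae_restrict_iff' measurableSet_Ioi).2 (Eventually.of_forall fun x hx => ?_)
    have hx0 : (0 : ℝ) < x := lt_trans one_pos hx
    rw [hnorm x hx0, Real.rpow_sub hx0, Real.rpow_natCast, div_eq_inv_mul]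
    have h2 : 0 ≤ x ^ l.re := Real.rpow_nonneg hx0.le _
    gcongr
    linarith

theorem isTemperedFun_xMinusFun {l : ℂ} (hl : -1 < l.re) : IsTemperedFun (xMinusFun l) := by
  obtain ⟨k, hk⟩ := isTemperedFun_xPlusFun hl
  refine ⟨k, ?_⟩
  have := hk.comp_neg
  simpa [xMinusFun_eq] using this

/-! ### The distributions `[x_+^l]` and `[x_-^l]` for all `l` -/

/-- Number of derivatives needed to reach the exponent `l` from the half-plane `Re > -1`. -/
def derivCount (l : ℂ) : ℕ := ⌊-l.re⌋₊

theorem neg_one_lt_re_add_derivCount (l : ℂ) : -1 < (l + (derivCount l : ℂ)).re := by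
  have := Nat.lt_floor_add_one (-l.re)
  simp only [Complex.add_re, Complex.natCast_re, derivCount]
  linarith

/-- The tempered distribution `[x_+^l]`: for `Re l > -1` it is the distribution of the function
`x_+^l` (no derivative is taken), and in general, with `n = derivCount l`,
`[x_+^l] = ((l + 1) ⋯ (l + n))⁻¹ (d/dx)^n [x_+^(l + n)]`.
(At `l = -1, -2, …` the value is irrelevant.) -/
def xPlus (l : ℂ) : 𝓢'(ℝ, ℂ) :=
  (∏ k ∈ Finset.range (derivCount l), (l + ((k + 1 : ℕ) : ℂ)))⁻¹ •
    ((TemperedDistribution.derivCLM ℂ)^[derivCount l]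
      (isTemperedFun_xPlusFun (neg_one_lt_re_add_derivCount l)).toDistribution)

/-- The tempered distribution `[x_-^l]`, built in the same way from
`(d/dx) [x_-^(l + 1)] = -(l + 1) [x_-^l]`. -/
def xMinus (l : ℂ) : 𝓢'(ℝ, ℂ) :=
  (∏ k ∈ Finset.range (derivCount l), -(l + ((k + 1 : ℕ) : ℂ)))⁻¹ •
    ((TemperedDistribution.derivCLM ℂ)^[derivCount l]
      (isTemperedFun_xMinusFun (neg_one_lt_re_add_derivCount l)).toDistribution)

/-- A family `T` of tempered distributions is holomorphic on `U` if `l ↦ ⟨T l, φ⟩` is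
holomorphic on `U` for every Schwartz function `φ`. -/
def IsHolomorphicFamily (U : Set ℂ) (T : ℂ → 𝓢'(ℝ, ℂ)) : Prop :=
  ∀ φ : 𝓢(ℝ, ℂ), DifferentiableOn ℂ (fun l => T l φ) U

/-! ### The semiclassical Fourier transform -/

/-- The dilation `x ↦ x / (2πh)` of the line. -/
def hDilation (h : ℝ) (hh : 0 < h) : ℝ ≃L[ℝ] ℝ :=
  ContinuousLinearEquiv.unitsEquivAut ℝ
    (Units.mk0 (2 * Real.pi * h)⁻¹ (inv_ne_zero (by positivity)))

theorem hDilation_apply (h : ℝ) (hh : 0 < h) (x : ℝ) :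
    hDilation h hh x = x / (2 * Real.pi * h) := by
  simp [hDilation, div_eq_mul_inv]

/-- The semiclassical Fourier transform on Schwartz functions, see `hFourierSchwartz_apply`. -/
def hFourierSchwartz (h : ℝ) (hh : 0 < h) : 𝓢(ℝ, ℂ) →L[ℂ] 𝓢(ℝ, ℂ) :=
  ((1 / √(2 * Real.pi * h) : ℝ) : ℂ) •
    ((SchwartzMap.compCLMOfContinuousLinearEquiv ℂ (hDilation h hh)) ∘L
      (FourierTransform.fourierCLM ℂ 𝓢(ℝ, ℂ)))

theorem hFourierSchwartz_apply (h : ℝ) (hh : 0 < h) (φ : 𝓢(ℝ, ℂ)) (x : ℝ) :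
    hFourierSchwartz h hh φ x =
      ((1 / √(2 * Real.pi * h) : ℝ) : ℂ) *
        ∫ t : ℝ, φ t * Complex.exp (-(Complex.I * x * t / h)) := by
  have hpi : (Real.pi : ℂ) ≠ 0 := by exact_mod_cast Real.pi_ne_zero
  have hc : (h : ℂ) ≠ 0 := by exact_mod_cast hh.ne'
  simp only [hFourierSchwartz, ContinuousLinearMap.comp_apply,
    smul_apply, SchwartzMap.compCLMOfContinuousLinearEquiv_apply, Function.comp_apply,
    FourierTransform.fourierCLM_apply, smul_eq_mul, hDilation_apply]
  rw [SchwartzMap.fourier_coe, Real.fourier_real_eq_integral_exp_smul]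
  congr 2
  ext t
  rw [smul_eq_mul, mul_comm]
  congr 2
  push_cast
  field_simp

/-- The semiclassical Fourier transform of a tempered distribution, defined by duality:
`⟨F_h T, φ⟩ = ⟨T, F_h φ⟩`. -/
def hFourier (h : ℝ) (hh : 0 < h) : 𝓢'(ℝ, ℂ) →L[ℂ] 𝓢'(ℝ, ℂ) :=
  PointwiseConvergenceCLM.precomp ℂ (hFourierSchwartz h hh)

theorem hFourier_apply (h : ℝ) (hh : 0 < h) (T : 𝓢'(ℝ, ℂ)) (φ : 𝓢(ℝ, ℂ)) :
    hFourier h hh T φ = T (hFourierSchwartz h hh φ) := rfl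

/-! ### The right-hand sides -/

/-- `i Γ(l + 1) h^(l + 1/2) / √(2π)
  (e^(iπl/2) [ξ_-^(-l-1)] - e^(-iπl/2) [ξ_+^(-l-1)])`. -/
def rhsPlus (h : ℝ) (l : ℂ) : 𝓢'(ℝ, ℂ) :=
  (Complex.I * Complex.Gamma (l + 1) / (√(2 * Real.pi) : ℝ) * (h : ℂ) ^ (l + 1 / 2)) •
    (Complex.exp (Complex.I * Real.pi / 2 * l) • xMinus (-l - 1) -
      Complex.exp (-(Complex.I * Real.pi / 2 * l)) • xPlus (-l - 1))

/-- `i Γ(l + 1) h^(l + 1/2) / √(2π)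
  (e^(iπl/2) [ξ_+^(-l-1)] - e^(-iπl/2) [ξ_-^(-l-1)])`. -/
def rhsMinus (h : ℝ) (l : ℂ) : 𝓢'(ℝ, ℂ) :=
  (Complex.I * Complex.Gamma (l + 1) / (√(2 * Real.pi) : ℝ) * (h : ℂ) ^ (l + 1 / 2)) •
    (Complex.exp (Complex.I * Real.pi / 2 * l) • xPlus (-l - 1) -
      Complex.exp (-(Complex.I * Real.pi / 2 * l)) • xMinus (-l - 1))

end

/-! On the strip `-1 < Re l < 0` both `x_+^l` and `ξ_±^(-l-1)` are locally integrable, so the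
formula there is an identity between convergent integrals. Insert a damping factor `e^(-εx)` and
apply Fubini; the inner integral is a Gamma integral with value `Γ(l+1) (ε + it/h)^(-l-1)`. As `ε →
0+`, dominated convergence gives `(it/h)^(-l-1)`, whose phase `e^(∓iπ(l+1)/2)` depends on the sign
of `t`; this produces the two terms on the right (`hFourier_xPlus_apply_of_strip`).

Off the strip the identity theorem applies, because both sides are holomorphic on the connected set
`ℂ ∖ ℤ`. Holomorphy of `[x_+^l]` comes from Mellin transforms: pairing with `φ` gives the Mellin
transform of `φ^(N)` at `l + N + 1`, up to sign, divided by `(l+1)⋯(l+N)`, for every large enough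
`N` (`xPlus_apply_of_derivCount_le`). The formula for `x_-^l` follows by reflection, and the limit
at `0` by continuity of the left-hand side. -/

/-! ### Mellin transforms of Schwartz functions -/

theorem SchwartzMap.isBigO_atTop_rpow (φ : 𝓢(ℝ, ℂ)) (s : ℝ) :
    (φ : ℝ → ℂ) =O[atTop] (fun x : ℝ => x ^ s) := by
  refine ((φ.isBigO_cocompact_rpow s).mono atTop_le_cocompact).congr' EventuallyEq.rfl ?_
  filter_upwards [eventually_ge_atTop 0] with x hx
  rw [Real.norm_of_nonneg hx]

theorem SchwartzMap.isBigO_nhdsGT_zero (φ : 𝓢(ℝ, ℂ)) :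
    (φ : ℝ → ℂ) =O[𝓝[>] 0] (fun x : ℝ => x ^ (-(0 : ℝ))) := by
  simp only [neg_zero, Real.rpow_zero]
  exact (φ.continuous.continuousAt.tendsto.mono_left nhdsWithin_le_nhds).isBigO_one ℝ

theorem SchwartzMap.mellinConvergent (φ : 𝓢(ℝ, ℂ)) {s : ℂ} (hs : 0 < s.re) :
    MellinConvergent φ s :=
  mellinConvergent_of_isBigO_rpow (φ.continuous.locallyIntegrable.locallyIntegrableOn _)
    (φ.isBigO_atTop_rpow (-(s.re + 1))) (lt_add_one _) φ.isBigO_nhdsGT_zero hs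

theorem SchwartzMap.differentiableAt_mellin (φ : 𝓢(ℝ, ℂ)) {s : ℂ} (hs : 0 < s.re) :
    DifferentiableAt ℂ (mellin φ) s :=
  mellin_differentiableAt_of_isBigO_rpow (φ.continuous.locallyIntegrable.locallyIntegrableOn _)
    (φ.isBigO_atTop_rpow (-(s.re + 1))) (lt_add_one _) φ.isBigO_nhdsGT_zero hs

/-- Integration by parts: the boundary term `x^s φ(x)` vanishes at `0` because `Re s > 0`, and at
infinity by the decay of `φ`. -/
theorem SchwartzMap.mellin_derivCLM (φ : 𝓢(ℝ, ℂ)) {s : ℂ} (hs : 0 < s.re) :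
    mellin (derivCLM ℂ ℂ φ) (s + 1) = -(s * mellin φ s) := by
  have hs0 : s ≠ 0 := by rintro rfl; simp at hs
  have h1 := (derivCLM ℂ ℂ φ).mellinConvergent (s := s + 1) (by simp; linarith)
  have h2 := φ.mellinConvergent hs
  simp only [MellinConvergent, smul_eq_mul, add_sub_cancel_right] at h1 h2
  have hb : ∀ x : ℝ, 0 < x → ‖(x : ℂ) ^ s‖ = x ^ s.re := fun x hx =>
    Complex.norm_cpow_eq_rpow_re_of_pos hx s
  have key := integral_Ioi_mul_deriv_eq_deriv_mul (a := 0) (a' := (0 : ℂ)) (b' := 0)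
    (u := fun x : ℝ => (x : ℂ) ^ s) (u' := fun x : ℝ => s * (x : ℂ) ^ (s - 1))
    (v := φ) (v' := derivCLM ℂ ℂ φ)
    (fun x (hx : 0 < x) => by
      simpa using! ((hasDerivAt_id (x : ℂ)).cpow_const (c := s)
        (Or.inl (by simpa using hx))).comp_ofReal)
    (fun x _ => φ.hasDerivAt x) h1
    (by
      refine (h2.const_mul s).congr (Eventually.of_forall fun x => ?_)
      simp [mul_assoc])
    (by
      have h3 : Tendsto (fun x : ℝ => (x : ℂ) ^ s) (𝓝[>] 0) (𝓝 0) := by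
        have := (Complex.continuousAt_ofReal_cpow_const 0 s (Or.inl hs)).tendsto
        rw [Complex.ofReal_zero, Complex.zero_cpow hs0] at this
        exact this.mono_left nhdsWithin_le_nhds
      simpa using! h3.mul (φ.continuous.continuousAt.tendsto.mono_left nhdsWithin_le_nhds))
    (by
      have h4 : (fun x : ℝ => (x : ℂ) ^ s * φ x) =O[atTop]
          fun x : ℝ => x ^ s.re * x ^ (-(s.re + 1)) := by
        refine Asymptotics.IsBigO.mul (Asymptotics.IsBigO.of_bound 1 ?_) (φ.isBigO_atTop_rpow _)
        filter_upwards [eventually_gt_atTop 0] with x hx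
        rw [hb x hx, one_mul]
        exact le_abs_self _
      refine h4.trans_tendsto ?_
      refine tendsto_inv_atTop_zero.congr' ?_
      filter_upwards [eventually_gt_atTop 0] with x hx
      rw [← Real.rpow_add hx, ← Real.rpow_neg_one]
      congr 1; ring)
  simp only [mellin, smul_eq_mul, add_sub_cancel_right]
  rw [key, ← integral_const_mul]
  simp [mul_assoc]

/-! ### Holomorphic continuation of `[x_+^l]` -/

theorem toDistribution_xPlusFun_apply {l : ℂ} (hl : -1 < l.re) (φ : 𝓢(ℝ, ℂ)) :
    (isTemperedFun_xPlusFun hl).toDistribution φ = mellin φ (l + 1) := by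
  rw [IsTemperedFun.toDistribution_apply, mellin, ← integral_indicator measurableSet_Ioi]
  congr 1
  ext x
  by_cases hx : 0 < x <;> simp [xPlusFun, hx]

theorem derivCLM_iterate_apply (n : ℕ) (T : 𝓢'(ℝ, ℂ)) (φ : 𝓢(ℝ, ℂ)) :
    ((TemperedDistribution.derivCLM ℂ)^[n] T) φ =
      (-1) ^ n * T ((SchwartzMap.derivCLM ℂ ℂ)^[n] φ) := by
  induction n generalizing φ with
  | zero => simp
  | succ n ih =>
    rw [Function.iterate_succ_apply', TemperedDistribution.derivCLM_apply_apply, map_neg, ih,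
      Function.iterate_succ_apply, pow_succ]
    ring

/-- Since `derivCount` jumps across vertical lines, holomorphy needs a formula whose `N` can be kept
fixed near a point. Passing from `N` to `N + 1` is one integration by parts at `s = l + N + 1`, and
the factor `s` it creates is exactly the new factor of the product, nonzero by `hl`. -/
theorem xPlus_apply_of_derivCount_le {l : ℂ} (hl : ∀ n : ℕ, l ≠ -((n : ℂ) + 1)) {N : ℕ}
    (hN : derivCount l ≤ N) (φ : 𝓢(ℝ, ℂ)) :
    xPlus l φ = (∏ k ∈ Finset.range N, (l + ((k + 1 : ℕ) : ℂ)))⁻¹ *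
      ((-1) ^ N * mellin ((SchwartzMap.derivCLM ℂ ℂ)^[N] φ) (l + N + 1)) := by
  induction N, hN using Nat.le_induction with
  | base =>
    rw [xPlus, _root_.smul_apply, derivCLM_iterate_apply,
      toDistribution_xPlusFun_apply (neg_one_lt_re_add_derivCount l), smul_eq_mul]
  | succ N hN ih =>
    have h1 := neg_one_lt_re_add_derivCount l
    have h2 : (derivCount l : ℝ) ≤ N := by exact_mod_cast hN
    have hs : 0 < (l + N + 1).re := by
      simp at h1 ⊢; linarith
    have hne : l + N + 1 ≠ 0 := fun h => hl N (by linear_combination h)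
    rw [ih, Finset.prod_range_succ, Function.iterate_succ_apply']
    have := SchwartzMap.mellin_derivCLM ((SchwartzMap.derivCLM ℂ ℂ)^[N] φ) hs
    push_cast
    rw [show l + (N + 1) + 1 = l + N + 1 + 1 by ring, this, mul_inv, pow_succ,
      show l + ((N : ℂ) + 1) = l + N + 1 by ring]
    field_simp

theorem xPlus_eq_toDistribution (l : ℂ) (hl : -1 < l.re) :
    xPlus l = (isTemperedFun_xPlusFun hl).toDistribution := by
  have h0 : derivCount l = 0 := Nat.floor_eq_zero.2 (by linarith)
  ext φ
  rw [toDistribution_xPlusFun_apply hl, xPlus_apply_of_derivCount_le (N := 0) _ h0.le]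
  · simp
  · rintro n rfl
    simp at hl
    have : (0 : ℝ) ≤ n := n.cast_nonneg
    linarith

theorem isHolomorphicFamily_xPlus :
    IsHolomorphicFamily {l : ℂ | ∀ n : ℕ, l ≠ -((n : ℂ) + 1)} xPlus := by
  intro φ l hl
  -- With this `N` the open condition `-N < Re z` holds at `l`, and it forces `derivCount z ≤ N` for
  -- all nearby `z`.
  set N := derivCount l + 1 with hN
  have hlN : -(N : ℝ) < l.re := by
    have := Nat.lt_floor_add_one (-l.re)
    rw [hN, derivCount]; push_cast; linarith
  have hev : ∀ᶠ z : ℂ in 𝓝 l, -(N : ℝ) < z.re :=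
    Complex.continuous_re.continuousAt.eventually_const_lt hlN
  have hd : DifferentiableAt ℂ (fun z : ℂ => (∏ k ∈ Finset.range N, (z + ((k + 1 : ℕ) : ℂ)))⁻¹ *
      ((-1) ^ N * mellin ((SchwartzMap.derivCLM ℂ ℂ)^[N] φ) (z + N + 1))) l := by
    refine DifferentiableAt.mul (DifferentiableAt.inv (by fun_prop) ?_)
      (DifferentiableAt.const_mul ?_ _)
    · refine Finset.prod_ne_zero_iff.2 fun k _ h => hl k ?_
      push_cast at h
      linear_combination h
    · have := SchwartzMap.differentiableAt_mellin ((SchwartzMap.derivCLM ℂ ℂ)^[N] φ)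
        (s := l + N + 1) (by simp; linarith)
      exact DifferentiableAt.comp (g := mellin _) l this (by fun_prop : DifferentiableAt ℂ (fun z : ℂ => z + N + 1) l)
  refine hd.differentiableWithinAt.congr_of_eventuallyEq_of_mem ?_ hl
  filter_upwards [self_mem_nhdsWithin, nhdsWithin_le_nhds hev] with z hz hzN
  refine xPlus_apply_of_derivCount_le hz ?_ φ
  exact Nat.floor_le_of_le (by linarith)

/-! ### Reflection and the family `[x_-^l]` -/

/-- Reflection `φ ↦ φ(-·)` of Schwartz functions. -/
noncomputable def SchwartzMap.reflect : 𝓢(ℝ, ℂ) →L[ℂ] 𝓢(ℝ, ℂ) :=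
  SchwartzMap.compCLMOfContinuousLinearEquiv ℂ (ContinuousLinearEquiv.neg ℝ)

@[simp]
theorem SchwartzMap.reflect_apply (φ : 𝓢(ℝ, ℂ)) (x : ℝ) : SchwartzMap.reflect φ x = φ (-x) := rfl

@[simp]
theorem SchwartzMap.reflect_reflect (φ : 𝓢(ℝ, ℂ)) :
    SchwartzMap.reflect (SchwartzMap.reflect φ) = φ := by
  ext x; simp

theorem SchwartzMap.derivCLM_iterate_reflect (n : ℕ) (φ : 𝓢(ℝ, ℂ)) :
    (derivCLM ℂ ℂ)^[n] (reflect φ) = (-1 : ℂ) ^ n • reflect ((derivCLM ℂ ℂ)^[n] φ) := by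
  induction n with
  | zero => simp
  | succ n ih =>
    rw [Function.iterate_succ_apply', ih, map_smul, Function.iterate_succ_apply', pow_succ,
      mul_smul]
    congr 1
    ext x
    have : (reflect ((derivCLM ℂ ℂ)^[n] φ) : ℝ → ℂ) = fun x => ((derivCLM ℂ ℂ)^[n] φ) (-x) := rfl
    rw [derivCLM_apply, this, deriv_comp_neg]
    simp

theorem toDistribution_xMinusFun_apply {l : ℂ} (hl : -1 < l.re) (φ : 𝓢(ℝ, ℂ)) :
    (isTemperedFun_xMinusFun hl).toDistribution φ = mellin φ.reflect (l + 1) := by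
  rw [← toDistribution_xPlusFun_apply hl, IsTemperedFun.toDistribution_apply,
    IsTemperedFun.toDistribution_apply, ← integral_neg_eq_self]
  simp [xMinusFun_eq]

/-- The sign `(-1)^n` from differentiating a reflected function `n` times cancels the one from the
factors `-(l + k + 1)`. Every fact about `xMinus` thereby reduces to `xPlus`. -/
theorem xMinus_apply (l : ℂ) (φ : 𝓢(ℝ, ℂ)) : xMinus l φ = xPlus l φ.reflect := by
  rw [xPlus, xMinus, _root_.smul_apply, _root_.smul_apply,
    derivCLM_iterate_apply, derivCLM_iterate_apply, SchwartzMap.derivCLM_iterate_reflect,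
    map_smul, toDistribution_xMinusFun_apply (neg_one_lt_re_add_derivCount l),
    toDistribution_xPlusFun_apply (neg_one_lt_re_add_derivCount l), Finset.prod_neg]
  simp only [Finset.card_range, smul_eq_mul, mul_inv, ← inv_pow, inv_neg_one]
  ring

theorem xPlus_apply_eq_xMinus (l : ℂ) (φ : 𝓢(ℝ, ℂ)) : xPlus l φ = xMinus l φ.reflect := by
  rw [xMinus_apply, SchwartzMap.reflect_reflect]

theorem xMinus_eq_toDistribution (l : ℂ) (hl : -1 < l.re) :
    xMinus l = (isTemperedFun_xMinusFun hl).toDistribution := by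
  ext φ
  rw [xMinus_apply, xPlus_eq_toDistribution l hl, toDistribution_xPlusFun_apply hl,
    toDistribution_xMinusFun_apply hl]

theorem isHolomorphicFamily_xMinus :
    IsHolomorphicFamily {l : ℂ | ∀ n : ℕ, l ≠ -((n : ℂ) + 1)} xMinus := fun φ => by
  simpa only [xMinus_apply] using isHolomorphicFamily_xPlus φ.reflect

/-! ### The Gamma integral with complex rate -/

theorem integrableOn_cpow_mul_exp_neg_mul_Ioi {a r : ℂ} (ha : 0 < a.re) (hr : 0 < r.re) :
    IntegrableOn (fun t : ℝ => (t : ℂ) ^ (a - 1) * Complex.exp (-(r * t))) (Ioi 0) := by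
  have h := integrableOn_rpow_mul_exp_neg_mul_rpow (s := a.re - 1) (p := 1) (b := r.re)
    (by linarith) one_pos hr
  refine Integrable.mono' h ((by fun_prop : Measurable fun t : ℝ =>
    (t : ℂ) ^ (a - 1) * Complex.exp (-(r * t))).aestronglyMeasurable.restrict) ?_
  refine (ae_restrict_iff' measurableSet_Ioi).2 (Eventually.of_forall fun x (hx : 0 < x) => ?_)
  rw [norm_mul, Complex.norm_cpow_eq_rpow_re_of_pos hx, Complex.norm_exp]
  simp

theorem differentiableAt_integral_cpow_mul_exp_neg_mul_Ioi {a r : ℂ} (ha : 0 < a.re)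
    (hr : 0 < r.re) : DifferentiableAt ℂ
      (fun r : ℂ => ∫ t : ℝ in Ioi 0, (t : ℂ) ^ (a - 1) * Complex.exp (-(r * t))) r := by
  -- Majorant of the `r`-derivative on the half-plane `Re z > Re r / 2`; the factor `t` brought down
  -- by differentiation raises the exponent from `Re a - 1` to `Re a`.
  have h := integrableOn_rpow_mul_exp_neg_mul_rpow (s := a.re) (p := 1) (b := r.re / 2)
    (by linarith) one_pos (by linarith)
  refine (hasDerivAt_integral_of_dominated_loc_of_deriv_le
    (s := {z : ℂ | r.re / 2 < z.re})
    (F' := fun (z : ℂ) (t : ℝ) => (t : ℂ) ^ (a - 1) * (Complex.exp (-(z * t)) * (-t)))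
    ((isOpen_lt continuous_const Complex.continuous_re).mem_nhds (by simp [hr]))
    (Eventually.of_forall fun z => (by fun_prop : Measurable fun t : ℝ =>
      (t : ℂ) ^ (a - 1) * Complex.exp (-(z * t))).aestronglyMeasurable.restrict)
    (integrableOn_cpow_mul_exp_neg_mul_Ioi ha hr)
    (by fun_prop : Measurable fun t : ℝ =>
      (t : ℂ) ^ (a - 1) * (Complex.exp (-(r * t)) * (-t))).aestronglyMeasurable.restrict
    ?_ h ?_).2.differentiableAt
  · refine (ae_restrict_iff' measurableSet_Ioi).2
      (Eventually.of_forall fun x (hx : 0 < x) z (hz : r.re / 2 < z.re) => ?_)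
    rw [norm_mul, norm_mul, Complex.norm_cpow_eq_rpow_re_of_pos hx, Complex.norm_exp, norm_neg,
      Complex.norm_real, Real.norm_of_nonneg hx.le, Complex.sub_re, Complex.one_re,
      Real.rpow_sub_one hx.ne', Real.rpow_one]
    have : (-(z * x)).re ≤ -(r.re / 2) * x := by simp; nlinarith
    calc x ^ a.re / x * (Real.exp (-(z * x)).re * x) = x ^ a.re * Real.exp (-(z * x)).re := by
          field_simp
      _ ≤ _ := by gcongr
  · refine Eventually.of_forall fun x z _ => HasDerivAt.const_mul _ ?_
    have : HasDerivAt (fun z : ℂ => -(z * x)) (-(x : ℂ)) z := by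
      simpa using! ((hasDerivAt_id z).mul_const (x : ℂ)).neg
    exact this.cexp

/-- The Gamma integral `∫_0^∞ t^(a-1) e^(-rt) dt = r^(-a) Γ(a)` for complex `r` with `Re r > 0`. -/
theorem integral_cpow_mul_exp_neg_mul_Ioi_of_re_pos {a r : ℂ} (ha : 0 < a.re) (hr : 0 < r.re) :
    ∫ t : ℝ in Ioi 0, (t : ℂ) ^ (a - 1) * Complex.exp (-(r * t)) =
      (1 / r) ^ a * Complex.Gamma a := by
  have hopen : IsOpen {z : ℂ | 0 < z.re} := isOpen_lt continuous_const Complex.continuous_re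
  have h1 : AnalyticOnNhd ℂ
      (fun r : ℂ => ∫ t : ℝ in Ioi 0, (t : ℂ) ^ (a - 1) * Complex.exp (-(r * t)))
      {z : ℂ | 0 < z.re} :=
    DifferentiableOn.analyticOnNhd (fun z hz =>
      (differentiableAt_integral_cpow_mul_exp_neg_mul_Ioi ha hz).differentiableWithinAt) hopen
  have h2 : AnalyticOnNhd ℂ (fun r : ℂ => (1 / r) ^ a * Complex.Gamma a) {z : ℂ | 0 < z.re} := by
    refine DifferentiableOn.analyticOnNhd (fun z (hz : 0 < z.re) => ?_) hopen
    have hz0 : z ≠ 0 := by rintro rfl; simp at hz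
    refine DifferentiableAt.differentiableWithinAt (DifferentiableAt.mul_const ?_ _)
    refine DifferentiableAt.cpow_const (by fun_prop (disch := assumption)) (Or.inl ?_)
    rw [one_div, Complex.inv_re]
    exact div_pos hz (Complex.normSq_pos.2 hz0)
  -- Identity theorem on the right half-plane: the two sides agree at positive real `r`, and these
  -- accumulate at `1`.
  refine h1.eqOn_of_preconnected_of_frequently_eq h2
    (convex_halfSpace_re_gt 0).isPreconnected (z₀ := 1) (by simp) ?_ hr
  have ht : Tendsto ((↑) : ℝ → ℂ) (𝓝[≠] 1) (𝓝[≠] 1) := by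
    refine tendsto_nhdsWithin_of_tendsto_nhds_of_eventually_within _ ?_ ?_
    · exact (Complex.continuous_ofReal.tendsto' 1 1 (by simp)).mono_left nhdsWithin_le_nhds
    · filter_upwards [self_mem_nhdsWithin] with x hx
      simpa using hx
  refine ht.frequently (Eventually.frequently ?_)
  filter_upwards [nhdsWithin_le_nhds (eventually_gt_nhds (zero_lt_one (α := ℝ)))] with x hx
  exact Complex.integral_cpow_mul_exp_neg_mul_Ioi ha hx

/-! ### The damped Fourier integral -/

/-- Damping makes the double integral absolutely convergent, since the oscillating exponential has
modulus one. After Fubini the `x`-integral is the Gamma integral with `r = ε + it/h`. -/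
theorem integral_cpow_mul_exp_mul_integral_exp {l : ℂ} (hl : -1 < l.re) {ε h : ℝ} (hε : 0 < ε)
    (φ : 𝓢(ℝ, ℂ)) :
    ∫ x : ℝ in Ioi 0, (x : ℂ) ^ l * Complex.exp (-(ε * x)) *
        ∫ t : ℝ, φ t * Complex.exp (-(Complex.I * x * t / h)) =
      Complex.Gamma (l + 1) * ∫ t : ℝ, φ t * (1 / (ε + Complex.I * t / h)) ^ (l + 1) := by
  have hl' : 0 < (l + 1).re := by simp; linarith
  have hint : Integrable (Function.uncurry fun x t : ℝ =>
      (x : ℂ) ^ l * Complex.exp (-(ε * x)) * (φ t * Complex.exp (-(Complex.I * x * t / h))))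
      ((volume.restrict (Ioi 0)).prod volume) := by
    have h1 := integrableOn_cpow_mul_exp_neg_mul_Ioi (r := ε) hl' (by simpa using hε)
    rw [add_sub_cancel_right] at h1
    have h2 := Integrable.mul_prod h1 (φ.integrable (μ := volume))
    have hc : Continuous fun p : ℝ × ℝ => Complex.exp (-(Complex.I * p.1 * p.2 / h)) := by
      fun_prop
    refine (h2.mul_bdd (c := 1) hc.aestronglyMeasurable (Eventually.of_forall fun p => ?_)).congr
      (Eventually.of_forall fun p => ?_)
    · rw [Complex.norm_exp]
      have : (-(Complex.I * p.1 * p.2 / h)).re = 0 := by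
        simp [Complex.div_re]
      simp [this]
    · simp only [Function.uncurry]; ring
  simp_rw [← integral_const_mul]
  rw [integral_integral_swap hint]
  congr 1
  ext t
  have hr : 0 < ((ε : ℂ) + Complex.I * t / h).re := by simpa [Complex.div_re] using hε
  have := integral_cpow_mul_exp_neg_mul_Ioi_of_re_pos hl' hr
  rw [add_sub_cancel_right] at this
  calc _ = ∫ x : ℝ in Ioi 0, φ t *
        ((x : ℂ) ^ l * Complex.exp (-((ε + Complex.I * t / h) * x))) := by
        congr 1; ext x
        rw [show -(((ε : ℂ) + Complex.I * t / h) * x) = -(ε * x) + -(Complex.I * x * t / h) by ring,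
          Complex.exp_add]
        ring
    _ = _ := by rw [integral_const_mul, this]; ring

theorem tendsto_integral_cpow_mul_exp {l : ℂ} (hl : -1 < l.re) (φ : 𝓢(ℝ, ℂ)) :
    Tendsto (fun ε : ℝ => ∫ x : ℝ in Ioi 0, (x : ℂ) ^ l * Complex.exp (-(ε * x)) * φ x)
      (𝓝[>] 0) (𝓝 (mellin φ (l + 1))) := by
  have hc := φ.mellinConvergent (s := l + 1) (by simp; linarith)
  simp only [MellinConvergent, smul_eq_mul, add_sub_cancel_right] at hc
  simp only [mellin, smul_eq_mul, add_sub_cancel_right]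
  refine tendsto_integral_filter_of_dominated_convergence _
    (Eventually.of_forall fun ε => ?_) ?_ hc.norm (Eventually.of_forall fun x => ?_)
  · exact ((by fun_prop : Measurable fun x : ℝ => (x : ℂ) ^ l *
      Complex.exp (-(ε * x))).aestronglyMeasurable.mul
      φ.continuous.aestronglyMeasurable).restrict
  · filter_upwards [self_mem_nhdsWithin] with ε (hε : 0 < ε)
    refine (ae_restrict_iff' measurableSet_Ioi).2 (Eventually.of_forall fun x (hx : 0 < x) => ?_)
    rw [norm_mul, norm_mul, norm_mul, Complex.norm_exp]
    have : Real.exp (-((ε : ℂ) * x)).re ≤ 1 := by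
      rw [Real.exp_le_one_iff]; simp; positivity
    gcongr
    exact mul_le_of_le_one_right (norm_nonneg _) this
  · have : Tendsto (fun ε : ℝ => (x : ℂ) ^ l * Complex.exp (-(ε * x)) * φ x) (𝓝 0)
        (𝓝 ((x : ℂ) ^ l * φ x)) := by
      refine Continuous.tendsto' (by fun_prop) _ _ (by simp)
    exact this.mono_left nhdsWithin_le_nhds

/-! ### Boundary values of the power as the damping tends to zero -/

/-- The base is `(h/t)` times `-i`, so its principal logarithm is `log h - log t - iπ/2`; the last
term is the source of the phase. -/
theorem one_div_I_mul_cpow_of_pos {h t : ℝ} (hh : 0 < h) (ht : 0 < t) (s : ℂ) :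
    (1 / (Complex.I * t / h)) ^ s =
      (h : ℂ) ^ s * (Complex.exp (-(Complex.I * Real.pi / 2 * s)) * (t : ℂ) ^ (-s)) := by
  have ht' : (t : ℂ) ≠ 0 := by exact_mod_cast ht.ne'
  have hh' : (h : ℂ) ≠ 0 := by exact_mod_cast hh.ne'
  have h1 : (1 / (Complex.I * t / h) : ℂ) = ((h / t : ℝ) : ℂ) * (-Complex.I) := by
    push_cast; field_simp; simp
  rw [h1, Complex.cpow_def_of_ne_zero (by simp [ht', hh']), Complex.cpow_def_of_ne_zero hh',
    Complex.cpow_def_of_ne_zero ht', Complex.log_ofReal_mul (by positivity) (by simp),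
    Complex.log_neg_I, ← Complex.exp_add, ← Complex.exp_add, Real.log_div hh.ne' ht.ne',
    ← Complex.ofReal_log hh.le, ← Complex.ofReal_log ht.le]
  congr 1
  push_cast
  ring

theorem one_div_I_mul_cpow_of_neg {h t : ℝ} (hh : 0 < h) (ht : t < 0) (s : ℂ) :
    (1 / (Complex.I * t / h)) ^ s =
      (h : ℂ) ^ s * (Complex.exp (Complex.I * Real.pi / 2 * s) * ((|t| : ℝ) : ℂ) ^ (-s)) := by
  rw [abs_of_neg ht]
  have hn : 0 < -t := by linarith
  have ht' : ((-t : ℝ) : ℂ) ≠ 0 := by exact_mod_cast hn.ne'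
  have hh' : (h : ℂ) ≠ 0 := by exact_mod_cast hh.ne'
  have h1 : (1 / (Complex.I * t / h) : ℂ) = ((h / (-t) : ℝ) : ℂ) * Complex.I := by
    have : (t : ℂ) ≠ 0 := by exact_mod_cast ht.ne
    push_cast; field_simp; simp
  rw [h1, Complex.cpow_def_of_ne_zero (mul_ne_zero (by exact_mod_cast (by positivity))
    Complex.I_ne_zero), Complex.cpow_def_of_ne_zero hh',
    Complex.cpow_def_of_ne_zero ht', Complex.log_ofReal_mul (by positivity) (by simp),
    Complex.log_I, ← Complex.exp_add, ← Complex.exp_add, Real.log_div hh.ne' hn.ne',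
    ← Complex.ofReal_log hh.le, ← Complex.ofReal_log hn.le]
  congr 1
  push_cast
  ring

theorem one_div_I_mul_cpow {h t : ℝ} (hh : 0 < h) (ht : t ≠ 0) (s : ℂ) :
    (1 / (Complex.I * t / h)) ^ s =
      (h : ℂ) ^ s * (Complex.exp (-(Complex.I * Real.pi / 2 * s)) * xPlusFun (-s) t +
        Complex.exp (Complex.I * Real.pi / 2 * s) * xMinusFun (-s) t) := by
  rcases lt_or_gt_of_ne ht with h0 | h0
  · rw [one_div_I_mul_cpow_of_neg hh h0]
    simp [xPlusFun, xMinusFun, h0, h0.le]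
  · rw [one_div_I_mul_cpow_of_pos hh h0]
    simp [xPlusFun, xMinusFun, h0, h0.le]

/-- A bound uniform in `ε`: the imaginary part alone gives `|ε + it/h| ≥ |t|/h`, and `|arg| ≤ π`
controls the contribution of `Im s`. For `t ≠ 0` exactly one of the two functions on the right is
nonzero, so their sum has modulus `|t|^(-Re s)`. -/
theorem norm_one_div_add_I_mul_cpow_le {ε h t : ℝ} (hh : 0 < h) (ht : t ≠ 0) {s : ℂ}
    (hs : 0 < s.re) :
    ‖(1 / (ε + Complex.I * t / h)) ^ s‖ ≤ h ^ s.re * Real.exp (Real.pi * |s.im|) *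
      ‖xPlusFun (-s) t + xMinusFun (-s) t‖ := by
  have hx : ‖xPlusFun (-s) t + xMinusFun (-s) t‖ = |t| ^ (-s.re) := by
    rcases lt_or_gt_of_ne ht with h0 | h0
    · simp only [xPlusFun, xMinusFun, mem_Ioi, not_lt.2 h0.le, not_false_eq_true,
        indicator_of_notMem, mem_Iio, h0, indicator_of_mem, zero_add]
      rw [Complex.norm_cpow_eq_rpow_re_of_pos (abs_pos.2 ht), Complex.neg_re]
    · simp only [xPlusFun, xMinusFun, mem_Ioi, not_lt.2 h0.le, not_false_eq_true,
        indicator_of_notMem, mem_Iio, h0, indicator_of_mem, add_zero]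
      rw [Complex.norm_cpow_eq_rpow_re_of_pos h0, Complex.neg_re, abs_of_pos h0]
  have hz : ‖(1 / (ε + Complex.I * t / h) : ℂ)‖ ≤ h * |t|⁻¹ := by
    have h1 : |t| / h ≤ ‖(ε + Complex.I * t / h : ℂ)‖ := by
      have := Complex.abs_im_le_norm (ε + Complex.I * t / h : ℂ)
      have h2 : (ε + Complex.I * t / h : ℂ).im = t / h := by
        rw [Complex.add_im, Complex.ofReal_im, Complex.div_ofReal_im]; simp
      rwa [h2, abs_div, abs_of_pos hh] at this
    rw [norm_div, norm_one, ← div_eq_mul_inv, div_le_iff₀ ((div_pos (abs_pos.2 ht) hh).trans_le h1)]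
    calc (1 : ℝ) = h / |t| * (|t| / h) := by
          have := abs_pos.2 ht
          field_simp
      _ ≤ _ := by gcongr
  refine (Complex.norm_cpow_le _ _).trans ?_
  rw [hx, div_eq_mul_inv, ← Real.exp_neg]
  have h3 : -(Complex.arg (1 / (ε + Complex.I * t / h) : ℂ) * s.im) ≤ Real.pi * |s.im| := by
    refine (neg_le_abs _).trans ?_
    rw [abs_mul]
    gcongr
    exact Complex.abs_arg_le_pi _
  calc _ ≤ (h * |t|⁻¹) ^ s.re * Real.exp (Real.pi * |s.im|) := by gcongr
    _ = _ := by
      rw [Real.mul_rpow hh.le (by positivity), Real.inv_rpow (abs_nonneg t),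
        Real.rpow_neg (abs_nonneg t)]
      ring

/-- Dominated convergence. The upper bound `Re l < 0` makes `|t|^(-Re l - 1)` integrable at the
origin, so the limiting distributions are given by functions. -/
theorem tendsto_integral_mul_one_div_cpow {l : ℂ} (hl : -1 < l.re) (hl' : l.re < 0) {h : ℝ}
    (hh : 0 < h) (φ : 𝓢(ℝ, ℂ)) :
    Tendsto (fun ε : ℝ => ∫ t : ℝ, φ t * (1 / (ε + Complex.I * t / h)) ^ (l + 1)) (𝓝[>] 0)
      (𝓝 ((h : ℂ) ^ (l + 1) *
        (Complex.exp (-(Complex.I * Real.pi / 2 * (l + 1))) * xPlus (-l - 1) φ +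
        Complex.exp (Complex.I * Real.pi / 2 * (l + 1)) * xMinus (-l - 1) φ))) := by
  have hm : -1 < (-l - 1).re := by simp; linarith
  have hs : 0 < (l + 1).re := by simp; linarith
  have hneg : -(l + 1) = -l - 1 := by ring
  have hp1 := (isTemperedFun_xPlusFun hm).integrable φ
  have hp2 := (isTemperedFun_xMinusFun hm).integrable φ
  have hlim : (h : ℂ) ^ (l + 1) *
        (Complex.exp (-(Complex.I * Real.pi / 2 * (l + 1))) * xPlus (-l - 1) φ +
        Complex.exp (Complex.I * Real.pi / 2 * (l + 1)) * xMinus (-l - 1) φ) =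
      ∫ t : ℝ, φ t * (1 / (Complex.I * t / h)) ^ (l + 1) := by
    rw [xPlus_eq_toDistribution _ hm, xMinus_eq_toDistribution _ hm,
      IsTemperedFun.toDistribution_apply, IsTemperedFun.toDistribution_apply,
      ← integral_const_mul, ← integral_const_mul,
      ← integral_add (hp1.const_mul _) (hp2.const_mul _), ← integral_const_mul]
    refine integral_congr_ae ?_
    filter_upwards [Measure.ae_ne volume 0] with t ht
    rw [one_div_I_mul_cpow hh ht, hneg]
    ring
  rw [hlim]
  refine tendsto_integral_filter_of_dominated_convergence
    (fun t => h ^ (l + 1).re * Real.exp (Real.pi * |(l + 1).im|) *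
      ‖xPlusFun (-l - 1) t * φ t + xMinusFun (-l - 1) t * φ t‖)
    (Eventually.of_forall fun ε => ?_) ?_ ((hp1.add hp2).norm.const_mul _) ?_
  · exact φ.continuous.aestronglyMeasurable.mul (by fun_prop : Measurable fun t : ℝ =>
      (1 / (ε + Complex.I * t / h) : ℂ) ^ (l + 1)).aestronglyMeasurable
  · refine Eventually.of_forall fun ε => ?_
    filter_upwards [Measure.ae_ne volume 0] with t ht
    have := norm_one_div_add_I_mul_cpow_le (ε := ε) hh ht hs
    rw [hneg] at this
    rw [← add_mul, norm_mul, norm_mul, mul_comm ‖φ t‖, ← mul_assoc]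
    gcongr
  · filter_upwards [Measure.ae_ne volume 0] with t ht
    refine Tendsto.const_mul _ ?_
    have hne : (Complex.I * t / h : ℂ) ≠ 0 := by simp [ht, hh.ne']
    have h1 : Tendsto (fun ε : ℝ => (1 / (ε + Complex.I * t / h) : ℂ)) (𝓝[>] 0)
        (𝓝 (1 / (Complex.I * t / h))) := by
      refine Tendsto.mono_left ?_ nhdsWithin_le_nhds
      refine tendsto_const_nhds.div (Continuous.tendsto' (by fun_prop) _ _ (by simp)) hne
    -- The limiting base is a nonzero imaginary number, hence off the branch cut of the power.
    refine h1.cpow tendsto_const_nhds (Or.inr ?_)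
    have h2 : (1 / (Complex.I * t / h) : ℂ) = -((h / t : ℝ) * Complex.I) := by
      have : (t : ℂ) ≠ 0 := by exact_mod_cast ht
      push_cast; field_simp; simp
    rw [h2]
    simp [ht, hh.ne']

/-! ### The formula on the strip `-1 < Re l < 0` -/

theorem rhsPlus_apply (h : ℝ) (l : ℂ) (φ : 𝓢(ℝ, ℂ)) : rhsPlus h l φ =
    (Complex.I * Complex.Gamma (l + 1) / (√(2 * Real.pi) : ℝ) * (h : ℂ) ^ (l + 1 / 2)) *
      (Complex.exp (Complex.I * Real.pi / 2 * l) * xMinus (-l - 1) φ -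
        Complex.exp (-(Complex.I * Real.pi / 2 * l)) * xPlus (-l - 1) φ) := rfl

theorem rhsMinus_apply (h : ℝ) (l : ℂ) (φ : 𝓢(ℝ, ℂ)) :
    rhsMinus h l φ = rhsPlus h l φ.reflect := by
  rw [rhsPlus_apply, ← xMinus_apply, ← xPlus_apply_eq_xMinus]
  rfl

theorem hFourier_xPlus_apply_of_strip {l : ℂ} (hl : -1 < l.re) (hl' : l.re < 0) {h : ℝ}
    (hh : 0 < h) (φ : 𝓢(ℝ, ℂ)) : hFourier h hh (xPlus l) φ = rhsPlus h l φ := by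
  have h1 := tendsto_integral_cpow_mul_exp hl (hFourierSchwartz h hh φ)
  have h2 := ((tendsto_integral_mul_one_div_cpow hl hl' hh φ).const_mul
    (Complex.Gamma (l + 1))).const_mul (((1 / √(2 * Real.pi * h) : ℝ) : ℂ))
  have h3 := tendsto_nhds_unique (h2.congr' (by
    filter_upwards [self_mem_nhdsWithin] with ε (hε : 0 < ε)
    rw [← integral_cpow_mul_exp_mul_integral_exp hl hε, ← integral_const_mul]
    congr 1; ext x
    rw [hFourierSchwartz_apply]; ring)) h1
  rw [hFourier_apply, xPlus_eq_toDistribution l hl, toDistribution_xPlusFun_apply hl, ← h3,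
    rhsPlus_apply]
  have hh' : (h : ℂ) ≠ 0 := by exact_mod_cast hh.ne'
  -- Matching constants: `√h` cancels against the normalisation `1/√(2πh)`, and replacing `l + 1` by
  -- `l` in the phases yields the factors `±i`, hence the common `i` and the minus sign.
  have hsq : (h : ℂ) ^ (l + 1) = (h : ℂ) ^ (l + 1 / 2) * (√h : ℝ) := by
    rw [Real.sqrt_eq_rpow, Complex.ofReal_cpow hh.le, ← Complex.cpow_add _ _ hh']
    congr 1; push_cast; ring
  have e1 : Complex.exp (Complex.I * Real.pi / 2 * (l + 1)) =
      Complex.exp (Complex.I * Real.pi / 2 * l) * Complex.I := by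
    rw [mul_add, Complex.exp_add, mul_one, show Complex.I * Real.pi / 2 = Real.pi / 2 * Complex.I by
      ring, Complex.exp_pi_div_two_mul_I]
  have e2 : Complex.exp (-(Complex.I * Real.pi / 2 * (l + 1))) =
      Complex.exp (-(Complex.I * Real.pi / 2 * l)) * (-Complex.I) := by
    rw [mul_add, neg_add, Complex.exp_add, mul_one,
      show -(Complex.I * Real.pi / 2) = -Real.pi / 2 * Complex.I by ring,
      Complex.exp_neg_pi_div_two_mul_I]
  have hs1 : ((√h : ℝ) : ℂ) ≠ 0 := by exact_mod_cast (Real.sqrt_pos.2 hh).ne'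
  have hs2 : ((√(2 * Real.pi) : ℝ) : ℂ) ≠ 0 := by
    exact_mod_cast (Real.sqrt_pos.2 (by positivity)).ne'
  rw [hsq, e1, e2, Real.sqrt_mul (by positivity)]
  push_cast
  field_simp
  ring

/-! ### Analytic continuation to `ℂ ∖ ℤ` -/

theorem isClosed_image_intCast (S : Set ℤ) : IsClosed (((↑) : ℤ → ℂ) '' S) := by
  have h := Complex.isometry_ofReal.isClosedEmbedding.isClosedMap _
    (Int.isClosedEmbedding_coe_real.isClosedMap _ (isClosed_discrete S))
  simpa [image_image] using h

theorem isOpen_integerComplement : IsOpen Complex.integerComplement := by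
  have h := isClosed_image_intCast univ
  rw [image_univ] at h
  exact h.isOpen_compl

theorem isOpen_setOf_ne_neg_natCast_add_one : IsOpen {l : ℂ | ∀ n : ℕ, l ≠ -((n : ℂ) + 1)} := by
  have h := (isClosed_image_intCast (range fun n : ℕ => -((n : ℤ) + 1))).isOpen_compl
  convert! h using 1
  ext l
  simp [eq_comm]

/-- Removing the integers removes all singularities: `Γ(l+1)` has its poles at `l = -1, -2, …`, and
`-l - 1` is a negative integer only for `l = 0, 1, 2, …`. -/
theorem isHolomorphicFamily_rhsPlus {h : ℝ} (hh : 0 < h) :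
    IsHolomorphicFamily Complex.integerComplement (rhsPlus h) := by
  intro φ l hl
  have hl0 : ∀ n : ℤ, l ≠ n := fun n hn => hl ⟨n, hn.symm⟩
  have hl1 : -l - 1 ∈ {l : ℂ | ∀ n : ℕ, l ≠ -((n : ℂ) + 1)} := fun n hn =>
    hl0 n (by push_cast; linear_combination -hn)
  have hopen : IsOpen {l : ℂ | ∀ n : ℕ, l ≠ -((n : ℂ) + 1)} := isOpen_setOf_ne_neg_natCast_add_one
  have hP : ∀ T : ℂ → 𝓢'(ℝ, ℂ), IsHolomorphicFamily {l : ℂ | ∀ n : ℕ, l ≠ -((n : ℂ) + 1)} T →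
      DifferentiableAt ℂ (fun z => T (-z - 1) φ) l := fun T hT =>
    DifferentiableAt.comp (g := fun z => T z φ) l ((hT φ).differentiableAt (hopen.mem_nhds hl1))
      (by fun_prop : DifferentiableAt ℂ (fun z : ℂ => -z - 1) l)
  have hG : DifferentiableAt ℂ (fun z => Complex.Gamma (z + 1)) l := by
    refine DifferentiableAt.comp (g := Complex.Gamma) l (Complex.differentiableAt_Gamma _ ?_)
      (by fun_prop)
    intro m hm
    exact hl0 (-m - 1) (by push_cast; linear_combination hm)
  have hpow : DifferentiableAt ℂ (fun z => (h : ℂ) ^ (z + 1 / 2)) l :=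
    DifferentiableAt.const_cpow (by fun_prop) (Or.inl (by exact_mod_cast hh.ne'))
  simp only [rhsPlus_apply]
  refine DifferentiableAt.differentiableWithinAt ?_
  exact ((((hG.const_mul _).div_const _).mul hpow).mul
    (((by fun_prop : DifferentiableAt ℂ _ l).mul (hP _ isHolomorphicFamily_xMinus)).sub
    ((by fun_prop : DifferentiableAt ℂ _ l).mul (hP _ isHolomorphicFamily_xPlus))))

theorem integerComplement_subset :
    Complex.integerComplement ⊆ {l : ℂ | ∀ n : ℕ, l ≠ -((n : ℂ) + 1)} := fun l hl n hn =>
  hl ⟨-(n + 1), by rw [hn]; push_cast; ring⟩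

theorem hFourier_xPlus {l : ℂ} (hl : l ∈ Complex.integerComplement) {h : ℝ} (hh : 0 < h) :
    hFourier h hh (xPlus l) = rhsPlus h l := by
  ext φ
  have hopen : IsOpen Complex.integerComplement := isOpen_integerComplement
  -- A countable set does not disconnect a real vector space of dimension greater than one.
  have hconn : IsPreconnected Complex.integerComplement :=
    ((countable_range _).isConnected_compl_of_one_lt_rank (by simp)).isPreconnected
  have h1 : AnalyticOnNhd ℂ (fun l => hFourier h hh (xPlus l) φ) Complex.integerComplement :=
    ((isHolomorphicFamily_xPlus (hFourierSchwartz h hh φ)).mono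
      integerComplement_subset).analyticOnNhd hopen
  have h2 : AnalyticOnNhd ℂ (fun l => rhsPlus h l φ) Complex.integerComplement :=
    (isHolomorphicFamily_rhsPlus hh φ).analyticOnNhd hopen
  refine h1.eqOn_of_preconnected_of_eventuallyEq h2 hconn (z₀ := -1 / 2) ?_ ?_ hl
  · rintro ⟨n, hn⟩
    have : 2 * n = -1 := by
      have h3 : (2 * n : ℂ) = -1 := by rw [hn]; ring
      exact_mod_cast h3
    omega
  · have e1 : ∀ᶠ z : ℂ in 𝓝 (-1 / 2), -1 < z.re :=
      Complex.continuous_re.continuousAt.eventually_const_lt (by norm_num)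
    have e2 : ∀ᶠ z : ℂ in 𝓝 (-1 / 2), z.re < 0 :=
      Complex.continuous_re.continuousAt.eventually_lt_const (by norm_num)
    filter_upwards [e1, e2] with z hz1 hz2
    exact hFourier_xPlus_apply_of_strip hz1 hz2 hh φ

/-! ### The reflected formula and the limit at zero -/

theorem hFourierSchwartz_reflect (h : ℝ) (hh : 0 < h) (φ : 𝓢(ℝ, ℂ)) :
    (hFourierSchwartz h hh φ).reflect = hFourierSchwartz h hh φ.reflect := by
  ext x
  rw [SchwartzMap.reflect_apply, hFourierSchwartz_apply, hFourierSchwartz_apply,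
    ← integral_neg_eq_self]
  simp

theorem hFourier_xMinus_apply (l : ℂ) {h : ℝ} (hh : 0 < h) (φ : 𝓢(ℝ, ℂ)) :
    hFourier h hh (xMinus l) φ = hFourier h hh (xPlus l) φ.reflect := by
  rw [hFourier_apply, xMinus_apply, hFourierSchwartz_reflect, hFourier_apply]

/-- The left-hand family is holomorphic, hence continuous, at `0`. The punctured unit disc contains
no integer, so there it coincides with the right-hand side, which inherits the limit. -/
theorem tendsto_rhsPlus {h : ℝ} (hh : 0 < h) :
    Tendsto (rhsPlus h) (𝓝[≠] 0) (𝓝 (hFourier h hh (xPlus 0))) := by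
  rw [PointwiseConvergenceCLM.tendsto_iff_forall_tendsto]
  intro φ
  have h0 : (0 : ℂ) ∈ {l : ℂ | ∀ n : ℕ, l ≠ -((n : ℂ) + 1)} := fun n hn => by
    have : ((n + 1 : ℕ) : ℂ) = 0 := by push_cast; linear_combination hn
    exact Nat.succ_ne_zero n (by exact_mod_cast this)
  have hc := (((isHolomorphicFamily_xPlus (hFourierSchwartz h hh φ)).differentiableAt
    (isOpen_setOf_ne_neg_natCast_add_one.mem_nhds h0)).continuousAt.tendsto.mono_left
    (nhdsWithin_le_nhds (s := {0}ᶜ)))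
  refine hc.congr' ?_
  have hb : ∀ᶠ z : ℂ in 𝓝[≠] 0, ‖z‖ < 1 := nhdsWithin_le_nhds
    (continuous_norm.continuousAt.eventually_lt_const (by simp))
  filter_upwards [self_mem_nhdsWithin, hb] with z hz hz1
  rw [← hFourier_xPlus _ hh, hFourier_apply]
  rintro ⟨n, rfl⟩
  rw [Complex.norm_intCast] at hz1
  have : |n| < 1 := by exact_mod_cast hz1
  rw [Int.abs_lt_one_iff] at this
  exact hz (by simp [this])

theorem mainTheorem4 :
    -- `[x_±^l]` is the holomorphic continuation to `ℂ ∖ {-1, -2, …}` of the functions `x_±^l`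
    (IsHolomorphicFamily {l : ℂ | ∀ n : ℕ, l ≠ -((n : ℂ) + 1)} xPlus ∧
      ∀ (l : ℂ) (hl : -1 < l.re), xPlus l = (isTemperedFun_xPlusFun hl).toDistribution) ∧
    (IsHolomorphicFamily {l : ℂ | ∀ n : ℕ, l ≠ -((n : ℂ) + 1)} xMinus ∧
      ∀ (l : ℂ) (hl : -1 < l.re), xMinus l = (isTemperedFun_xMinusFun hl).toDistribution) ∧
    ∀ (h : ℝ) (hh : 0 < h),
      -- the formulas for `l ∈ ℂ ∖ ℤ`
      (∀ l : ℂ, (∀ n : ℤ, l ≠ (n : ℂ)) →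
        hFourier h hh (xPlus l) = rhsPlus h l ∧ hFourier h hh (xMinus l) = rhsMinus h l) ∧
      -- the formulas for `l = 0`, where the right-hand sides are understood as limits
      Tendsto (rhsPlus h) (𝓝[≠] 0) (𝓝 (hFourier h hh (xPlus 0))) ∧
      Tendsto (rhsMinus h) (𝓝[≠] 0) (𝓝 (hFourier h hh (xMinus 0))) := by
  refine ⟨⟨isHolomorphicFamily_xPlus, xPlus_eq_toDistribution⟩,
    ⟨isHolomorphicFamily_xMinus, xMinus_eq_toDistribution⟩, fun h hh => ⟨fun l hl => ?_,
      tendsto_rhsPlus hh, ?_⟩⟩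
  · have hl' : l ∈ Complex.integerComplement := fun ⟨n, hn⟩ => hl n hn.symm
    refine ⟨hFourier_xPlus hl' hh, ?_⟩
    ext φ
    rw [hFourier_xMinus_apply, hFourier_xPlus hl' hh, rhsMinus_apply]
  · rw [PointwiseConvergenceCLM.tendsto_iff_forall_tendsto]
    intro φ
    simp only [rhsMinus_apply, hFourier_xMinus_apply]
    exact PointwiseConvergenceCLM.tendsto_iff_forall_tendsto.1 (tendsto_rhsPlus hh) φ.reflect
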